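/- All semigroups are ordered abelian semigroups $M$ with a zero element $0$ which is the least element, and with $a+c\le b+c$ whenever $a\le b$. For $a,b\in M$ write $a\ll b$ if, whenever $(c_n)_{n\in\mathbb N}$ is an increasing sequence that has a supremum in $M$ and $b\le\sup_n c_n$, there is $n_0$ with $a\le c_{n_0}$. A sequence $(a_n)$ is rapidly increasing if $a_n\ll a_{n+1}$ for all $n$. Such an $M$ is an object of the category $\mathrm{Cu}$ if (i) every increasing sequence in $M$ has a supremum in $M$; (ii) every element of $M$ is the supremum of a rapidly increasing sequence; and (iii) suprema of increasing sequences and the relation $\ll$ are compatible with addition, that is, $\sup_n(a_n+b_n)=\sup_n a_n+\sup_n b_n$ for increasing sequences $(a_n),(b_n)$, and $a\ll a'$, $b\ll b'$ imply $a+b\ll a'+b'$. An object $M$ of $\mathrm{Cu}$ is countably based if there is a countable subset $B\subseteq M$ such that every element of $M$ is the supremum of a rapidly increasing sequence of elements of $B$. For a topological space $X$ and an object $M$ of $\mathrm{Cu}$, let $\mathrm{Lsc}(X,M)$ be the set of functions $f\colon X\to M$ such that $\{t\in X : a\ll f(t)\}$ is open in $X$ for every $a\in M$. **Theorem.** Let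 $X$ be a second countable compact Hausdorff space of finite covering dimension, and let $M$ be a countably based object of $\mathrm{Cu}$. Then $\mathrm{Lsc}(X,M)$, equipped with the pointwise order and pointwise addition, is an object of $\mathrm{Cu}$. -/

import Mathlib

/-- Sequential compact containment `a ≪ b` in an ordered set: whenever an increasing sequence `c`
has a supremum `s` with `b ≤ s`, some `c n` is already above `a`. -/
def CompactlyContained {M : Type*} [Preorder M] (a b : M) : Prop :=
  ∀ (c : ℕ → M) (s : M), Monotone c → IsLUB (Set.range c) s → b ≤ s → ∃ n, a ≤ c n

/-- A sequence `a` with `a n ≪ a (n + 1)` for all `n`. -/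
def RapidlyIncreasing {M : Type*} [Preorder M] (a : ℕ → M) : Prop :=
  ∀ n, CompactlyContained (a n) (a (n + 1))

/-- `M` is (an object of the category `Cu`, that is) an ordered abelian semigroup of positive
elements, with zero, which is closed under suprema of increasing sequences, in which every element
is the supremum of a rapidly increasing sequence, and in which the operation of taking suprema of
increasing sequences and the relation `≪` are compatible with addition. -/
class CuSemigroup (M : Type*) [AddCommMonoid M] [PartialOrder M] : Prop
    extends IsOrderedAddMonoid M where
  zero_le' : ∀ a : M, 0 ≤ a
  exists_isLUB : ∀ a : ℕ → M, Monotone a → ∃ s, IsLUB (Set.range a) s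
  exists_rapidlyIncreasing : ∀ x : M, ∃ a : ℕ → M, RapidlyIncreasing a ∧ IsLUB (Set.range a) x
  isLUB_add : ∀ (a b : ℕ → M) (x y : M), Monotone a → Monotone b →
    IsLUB (Set.range a) x → IsLUB (Set.range b) y →
      IsLUB (Set.range fun n => a n + b n) (x + y)
  compactlyContained_add : ∀ a a' b b' : M, CompactlyContained a a' → CompactlyContained b b' →
    CompactlyContained (a + b) (a' + b')

/-- There is a countable subset `B` of `M` such that every element of `M` is the supremum of a
rapidly increasing sequence of elements of `B`. -/
def CountablyBased (M : Type*) [Preorder M] : Prop :=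
  ∃ B : Set M, B.Countable ∧
    ∀ x : M, ∃ a : ℕ → M, (∀ n, a n ∈ B) ∧ RapidlyIncreasing a ∧ IsLUB (Set.range a) x

/-- `f : X → M` is lower semicontinuous if `{t | a ≪ f t}` is open for every `a`. -/
def IsLsc {X M : Type*} [TopologicalSpace X] [Preorder M] (f : X → M) : Prop :=
  ∀ a : M, IsOpen {t | CompactlyContained a (f t)}

/-- Every open cover of `X` has an open refinement of multiplicity at most `n + 1`. -/
def CoveringDimLE (X : Type*) [TopologicalSpace X] (n : ℕ) : Prop :=
  ∀ 𝒰 : Set (Set X), (∀ U ∈ 𝒰, IsOpen U) → ⋃₀ 𝒰 = Set.univ →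
    ∃ 𝒱 : Set (Set X), (∀ V ∈ 𝒱, IsOpen V) ∧ ⋃₀ 𝒱 = Set.univ ∧
      (∀ V ∈ 𝒱, ∃ U ∈ 𝒰, V ⊆ U) ∧ ∀ x : X, {V ∈ 𝒱 | x ∈ V}.encard ≤ n + 1

/-- The covering dimension: the least `n` with `CoveringDimLE X n`, or `⊤` if there is none. -/
noncomputable def coveringDim (X : Type*) [TopologicalSpace X] : ℕ∞ :=
  sInf {d : ℕ∞ | ∃ n : ℕ, d = n ∧ CoveringDimLE X n}

theorem CompactlyContained.le {M : Type*} [Preorder M] {a b : M}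
    (h : CompactlyContained a b) : a ≤ b := by
  obtain ⟨n, hn⟩ := h (fun _ => b) b monotone_const (by simp [Set.range_const]) le_rfl
  exact hn

theorem CompactlyContained.trans_le {M : Type*} [Preorder M] {a b c : M}
    (h : CompactlyContained a b) (hbc : b ≤ c) : CompactlyContained a c :=
  fun u s hu hs hc => h u s hu hs (hbc.trans hc)

theorem CompactlyContained.le_trans {M : Type*} [Preorder M] {a b c : M}
    (hab : a ≤ b) (h : CompactlyContained b c) : CompactlyContained a c :=
  fun u s hu hs hc => (h u s hu hs hc).imp fun _ hn => hab.trans hn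

theorem IsLsc.add {X M : Type*} [TopologicalSpace X] [AddCommMonoid M] [PartialOrder M]
    [CuSemigroup M] {f g : X → M} (hf : IsLsc f) (hg : IsLsc g) : IsLsc (f + g) := by
  intro a
  rw [isOpen_iff_mem_nhds]
  intro t ht
  obtain ⟨u, hu, hus⟩ := CuSemigroup.exists_rapidlyIncreasing (f t)
  obtain ⟨v, hv, hvs⟩ := CuSemigroup.exists_rapidlyIncreasing (g t)
  have hum : Monotone u := monotone_nat_of_le_succ fun n => (hu n).le
  have hvm : Monotone v := monotone_nat_of_le_succ fun n => (hv n).le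
  obtain ⟨n, hn⟩ := ht (fun n => u n + v n) (f t + g t)
    (fun i j hij => add_le_add (hum hij) (hvm hij))
    (CuSemigroup.isLUB_add u v _ _ hum hvm hus hvs) le_rfl
  have h1 : CompactlyContained (u n) (f t) := (hu n).trans_le (hus.1 ⟨n + 1, rfl⟩)
  have h2 : CompactlyContained (v n) (g t) := (hv n).trans_le (hvs.1 ⟨n + 1, rfl⟩)
  filter_upwards [(hf (u n)).mem_nhds h1, (hg (v n)).mem_nhds h2] with s hs1 hs2
  exact CompactlyContained.le_trans hn (CuSemigroup.compactlyContained_add _ _ _ _ hs1 hs2)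

/-- `Lsc(X, M)`: the lower semicontinuous functions `X → M`. As a submonoid of `X → M` it carries
the pointwise addition and the pointwise order. -/
def Lsc (X M : Type*) [TopologicalSpace X] [AddCommMonoid M] [PartialOrder M]
    [CuSemigroup M] : AddSubmonoid (X → M) where
  carrier := {f | IsLsc f}
  zero_mem' := fun a => isOpen_const (p := CompactlyContained a (0 : M))
  add_mem' := IsLsc.add

open Topology

/-! Suprema of increasing sequences in `Lsc X M` are pointwise, so the work lies in understanding
`≪` and in producing rapidly increasing sequences. Both go through `LocallyWayBelow`, a local
relation that visibly respects addition and, by compactness, implies `≪`. Once every `f` is the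
supremum of a sequence increasing for the local relation, the two relations coincide.

Such a sequence absorbs, one at a time, countably many step functions (`b` on a basic open set, `0`
elsewhere) whose supremum is `f`. This needs interpolation, where finite dimension enters: since `M`
need not have joins, local values cannot simply be glued. Instead, take successive finite covers
with increasing values and a common refinement of multiplicity at most `n + 1`, and let the number
of refining sets containing `x` say which cover supplies the value at `x`. That number can only grow
near `x`, which yields lower semicontinuity. -/

theorem CompactlyContained.exists_between {M : Type*} [AddCommMonoid M] [PartialOrder M]
    [CuSemigroup M] {a b : M} (h : CompactlyContained a b) :
    ∃ c, CompactlyContained a c ∧ CompactlyContained c b := by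
  obtain ⟨u, hu, hs⟩ := CuSemigroup.exists_rapidlyIncreasing b
  obtain ⟨n, hn⟩ := h u b (monotone_nat_of_le_succ fun n => (hu n).le) hs le_rfl
  exact ⟨u (n + 1), .le_trans hn (hu n), (hu _).trans_le (hs.1 ⟨n + 2, rfl⟩)⟩

theorem CompactlyContained.zero_left {M : Type*} [AddCommMonoid M] [PartialOrder M]
    [CuSemigroup M] (b : M) : CompactlyContained 0 b :=
  fun _ _ _ _ _ => ⟨0, CuSemigroup.zero_le' _⟩

/-- Finitely many elements compactly contained in `x` are compactly contained in a common element
that is itself compactly contained in `x`. -/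
theorem CompactlyContained.exists_finite_upper_bound {M : Type*} [AddCommMonoid M]
    [PartialOrder M] [CuSemigroup M] {x : M} {s : Set M} (hs : s.Finite)
    (h : ∀ a ∈ s, CompactlyContained a x) :
    ∃ c, (∀ a ∈ s, CompactlyContained a c) ∧ CompactlyContained c x := by
  obtain ⟨u, hu, hux⟩ := CuSemigroup.exists_rapidlyIncreasing x
  have hum : Monotone u := monotone_nat_of_le_succ fun n => (hu n).le
  have key : ∀ a ∈ s, ∃ n, a ≤ u n := fun a ha => h a ha u x hum hux le_rfl
  choose! n hn using key
  obtain ⟨N, hN⟩ := (hs.image n).bddAbove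
  exact ⟨u (N + 1),
    fun a ha => .le_trans ((hn a ha).trans (hum (hN ⟨a, ha, rfl⟩))) (hu N),
    (hu _).trans_le (hux.1 ⟨N + 2, rfl⟩)⟩

/-- A pointwise supremum of an increasing sequence of lower semicontinuous functions is lower
semicontinuous. -/
theorem IsLsc.of_isLUB {X M : Type*} [TopologicalSpace X] [AddCommMonoid M] [PartialOrder M]
    [CuSemigroup M] {u : ℕ → X → M} {g : X → M} (hu : ∀ n, IsLsc (u n)) (hm : Monotone u)
    (hg : ∀ x, IsLUB (Set.range fun n => u n x) (g x)) : IsLsc g := by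
  intro a
  have : {t | CompactlyContained a (g t)} = ⋃ n, {t | CompactlyContained a (u n t)} := by
    ext t
    simp only [Set.mem_ofPred_eq, Set.mem_iUnion]
    constructor
    · intro h
      obtain ⟨c, hac, hc⟩ := h.exists_between
      obtain ⟨n, hn⟩ := hc (fun n => u n t) (g t) (fun i j hij => hm hij t) (hg t) le_rfl
      exact ⟨n, hac.trans_le hn⟩
    · rintro ⟨n, hn⟩
      exact hn.trans_le ((hg t).1 ⟨n, rfl⟩)
  rw [this]
  exact isOpen_iUnion fun n => hu n a

/-! ### Suprema in `Lsc X M` -/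

namespace Lsc

variable {X M : Type*} [TopologicalSpace X] [AddCommMonoid M] [PartialOrder M] [CuSemigroup M]

theorem isLUB_of_pointwise {u : ℕ → Lsc X M} {g : Lsc X M}
    (h : ∀ x, IsLUB (Set.range fun n => (u n : X → M) x) ((g : X → M) x)) :
    IsLUB (Set.range u) g := by
  constructor
  · rintro _ ⟨n, rfl⟩ x
    exact (h x).1 ⟨n, rfl⟩
  · intro k hk x
    refine (h x).2 ?_
    rintro _ ⟨n, rfl⟩
    exact hk ⟨n, rfl⟩ x

theorem exists_pointwise_isLUB {u : ℕ → Lsc X M} (hu : Monotone u) :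
    ∃ g : Lsc X M, ∀ x, IsLUB (Set.range fun n => (u n : X → M) x) ((g : X → M) x) := by
  have hm : ∀ x, Monotone fun n => (u n : X → M) x := fun x i j hij => hu hij x
  choose g hg using fun x => CuSemigroup.exists_isLUB _ (hm x)
  exact ⟨⟨g, IsLsc.of_isLUB (fun n => (u n).2) (fun i j hij => hu hij) hg⟩, hg⟩

theorem pointwise_isLUB {u : ℕ → Lsc X M} (hu : Monotone u) {g : Lsc X M}
    (h : IsLUB (Set.range u) g) (x : X) :
    IsLUB (Set.range fun n => (u n : X → M) x) ((g : X → M) x) := by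
  obtain ⟨k, hk⟩ := exists_pointwise_isLUB hu
  rw [h.unique (isLUB_of_pointwise hk)]
  exact hk x

end Lsc

/-- Near every point `x`, the function `h` is bounded by an element compactly contained in
`f x`. -/
def LocallyWayBelow {X M : Type*} [TopologicalSpace X] [Preorder M] (h f : X → M) : Prop :=
  ∀ x, ∃ c, CompactlyContained c (f x) ∧ ∀ᶠ y in 𝓝 x, h y ≤ c

namespace LocallyWayBelow

theorem le {X M : Type*} [TopologicalSpace X] [Preorder M] {h f : X → M} (hf : LocallyWayBelow h f) : h ≤ f := fun x => by
  obtain ⟨c, hc, hy⟩ := hf x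
  exact hy.self_of_nhds.trans hc.le

theorem mono {X M : Type*} [TopologicalSpace X] [Preorder M] {h h' f f' : X → M} (hf : LocallyWayBelow h f) (hh : h' ≤ h) (hff : f ≤ f') :
    LocallyWayBelow h' f' := fun x => by
  obtain ⟨c, hc, hy⟩ := hf x
  exact ⟨c, hc.trans_le (hff x), hy.mono fun y h => (hh y).trans h⟩

variable {X M : Type*} [TopologicalSpace X] [AddCommMonoid M] [PartialOrder M] [CuSemigroup M]

theorem add {h h' f f' : X → M} (hf : LocallyWayBelow h f) (hf' : LocallyWayBelow h' f') :
    LocallyWayBelow (h + h') (f + f') := fun x => by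
  obtain ⟨c, hc, hy⟩ := hf x
  obtain ⟨c', hc', hy'⟩ := hf' x
  refine ⟨c + c', CuSemigroup.compactlyContained_add _ _ _ _ hc hc', ?_⟩
  filter_upwards [hy, hy'] with y h1 h2 using add_le_add h1 h2

theorem compactlyContained [CompactSpace X] {h f : Lsc X M}
    (hf : LocallyWayBelow (h : X → M) (f : X → M)) : CompactlyContained h f := by
  intro u s hu hs hfs
  have key : ∀ x, ∃ n, ∀ᶠ y in 𝓝 x, (h : X → M) y ≤ (u n : X → M) y := by
    intro x
    obtain ⟨c, hc, hy⟩ := hf x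
    -- The intermediate `d` turns `d ≤ u n x` into `c ≪ u n x`, which is an open condition on the
    -- point.
    obtain ⟨d, hcd, hd⟩ := hc.exists_between
    obtain ⟨n, hn⟩ := hd _ _ (fun i j hij => hu hij x) (Lsc.pointwise_isLUB hu hs x) (hfs x)
    refine ⟨n, ?_⟩
    filter_upwards [hy, ((u n).2 c).mem_nhds (hcd.trans_le hn)] with y h1 h2
    exact h1.trans h2.le
  choose n hn using key
  obtain ⟨t, ht⟩ := CompactSpace.elim_nhds_subcover _ hn
  obtain ⟨N, hN⟩ := (t.image n).bddAbove
  refine ⟨N, fun y => ?_⟩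
  have hy : y ∈ ⋃ x ∈ t, {y | (h : X → M) y ≤ (u (n x) : X → M) y} := by
    rw [ht]; trivial
  simp only [Set.mem_iUnion] at hy
  obtain ⟨x, hx, hxy⟩ := hy
  exact le_trans hxy (hu (hN (Finset.mem_coe.2 (Finset.mem_image_of_mem n hx))) y)

/-- The function equal to `b` on `K` and to `0` elsewhere is locally way below `f` as soon as `b`
is compactly contained in the values of `f` on the closure of `K`. -/
theorem indicator {K : Set X} {b : M} {f : X → M}
    (h : ∀ y ∈ closure K, CompactlyContained b (f y)) :
    LocallyWayBelow (K.indicator fun _ => b) f := by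
  intro x
  by_cases hx : x ∈ closure K
  · refine ⟨b, h x hx, Filter.Eventually.of_forall fun y => ?_⟩
    by_cases hy : y ∈ K
    · simp [hy]
    · simpa [hy] using CuSemigroup.zero_le' b
  · refine ⟨0, .zero_left _, ?_⟩
    filter_upwards [isClosed_closure.isOpen_compl.mem_nhds hx] with y hy
    simp [Set.indicator_of_notMem (fun h => hy (subset_closure h))]

end LocallyWayBelow

/-! ### Interpolation from finite covering dimension -/

section Interpolation

variable {X M : Type*} [TopologicalSpace X] [AddCommMonoid M] [PartialOrder M] [CuSemigroup M]

/-- A finite family of open sets with values compactly contained in `f` on the closures. -/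
def IsSubordinate (f : X → M) (P : Set (Set X × M)) : Prop :=
  P.Finite ∧ ∀ p ∈ P, IsOpen p.1 ∧ ∀ y ∈ closure p.1, CompactlyContained p.2 (f y)

/-- A subordinate family can be followed by a subordinate cover whose values dominate those of all
members of the given family that they meet, and also dominate two given functions. -/
theorem exists_dominating_cover [CompactSpace X] [T2Space X] {h₁ h₂ f : X → M} (hf : IsLsc f)
    (h₁f : LocallyWayBelow h₁ f) (h₂f : LocallyWayBelow h₂ f)
    {Q : Set (Set X × M)} (hQ : IsSubordinate f Q) :
    ∃ P : Set (Set X × M), IsSubordinate f P ∧ (∀ x, ∃ p ∈ P, x ∈ p.1) ∧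
      (∀ p ∈ P, ∃ c, CompactlyContained c p.2 ∧ ∀ y ∈ p.1, h₁ y ≤ c) ∧
      (∀ p ∈ P, ∃ c, CompactlyContained c p.2 ∧ ∀ y ∈ p.1, h₂ y ≤ c) ∧
      ∀ q ∈ Q, ∀ p ∈ P, (q.1 ∩ p.1).Nonempty → q.2 ≤ p.2 := by
  have key : ∀ x, ∃ p : Set X × M, x ∈ p.1 ∧ IsOpen p.1 ∧
      (∀ y ∈ closure p.1, CompactlyContained p.2 (f y)) ∧
      (∃ c, CompactlyContained c p.2 ∧ ∀ y ∈ p.1, h₁ y ≤ c) ∧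
      (∃ c, CompactlyContained c p.2 ∧ ∀ y ∈ p.1, h₂ y ≤ c) ∧
      ∀ q ∈ Q, (q.1 ∩ p.1).Nonempty → q.2 ≤ p.2 := by
    intro x
    obtain ⟨c₁, hc₁, hy₁⟩ := h₁f x
    obtain ⟨c₂, hc₂, hy₂⟩ := h₂f x
    -- Only the members of `Q` whose closure contains `x` constrain the value at `x`; the others are
    -- avoided by shrinking the neighbourhood.
    have hfin : (insert c₁ (insert c₂ (Prod.snd '' {q ∈ Q | x ∈ closure q.1}))).Finite :=
      (((hQ.1.subset (Set.sep_subset _ _)).image _).insert _).insert _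
    obtain ⟨a, ha, hax⟩ := CompactlyContained.exists_finite_upper_bound (x := f x) hfin (by
      rintro b (rfl | rfl | ⟨q, ⟨hq, hxq⟩, rfl⟩)
      exacts [hc₁, hc₂, (hQ.2 q hq).2 x hxq])
    have hfar : ∀ᶠ y in 𝓝 x, ∀ q ∈ Q, x ∉ closure q.1 → y ∉ q.1 := by
      refine (Filter.eventually_all_finite hQ.1).2 fun q _ => ?_
      by_cases hx : x ∈ closure q.1
      · exact Filter.Eventually.of_forall fun y h => absurd hx h
      · filter_upwards [isClosed_closure.isOpen_compl.mem_nhds hx] with y hy _ hyq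
        exact hy (subset_closure hyq)
    have hnhds := (hy₁.and (hy₂.and hfar)).and ((hf a).mem_nhds hax)
    obtain ⟨N, ⟨hxN, hNo⟩, hN⟩ := (nhds_basis_opens x).lift'_closure.mem_iff.1
      (by rw [lift'_nhds_closure]; exact hnhds)
    refine ⟨(N, a), hxN, hNo, fun y hy => (hN hy).2, ⟨c₁, ha _ (by simp), fun y hy =>
      (hN (subset_closure hy)).1.1⟩, ⟨c₂, ha _ (by simp), fun y hy =>
      (hN (subset_closure hy)).1.2.1⟩, ?_⟩
    rintro q hq ⟨y, hyq, hyN⟩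
    refine (ha q.2 (.inr (.inr ⟨q, ⟨hq, ?_⟩, rfl⟩))).le
    by_contra hx
    exact (hN (subset_closure hyN)).1.2.2 q hq hx hyq
  choose p hxp hpo hpf hp₁ hp₂ hpQ using key
  obtain ⟨t, ht⟩ := CompactSpace.elim_nhds_subcover (fun x => (p x).1)
    fun x => (hpo x).mem_nhds (hxp x)
  refine ⟨p '' t, ⟨t.finite_toSet.image _, ?_⟩, fun x => ?_, ?_, ?_, ?_⟩
  · rintro _ ⟨x, -, rfl⟩
    exact ⟨hpo x, hpf x⟩
  · have hx : x ∈ ⋃ y ∈ t, (p y).1 := by rw [ht]; trivial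
    simp only [Set.mem_iUnion] at hx
    obtain ⟨y, hy, hxy⟩ := hx
    exact ⟨p y, ⟨y, hy, rfl⟩, hxy⟩
  · rintro _ ⟨x, -, rfl⟩
    exact hp₁ x
  · rintro _ ⟨x, -, rfl⟩
    exact hp₂ x
  · rintro q hq _ ⟨x, -, rfl⟩
    exact hpQ x q hq

/-- Finite covers `P 0, P 1, …` subordinate to `f` and dominating `h₁` and `h₂`, with values that
increase from each cover to the later ones. -/
theorem exists_dominating_covers [CompactSpace X] [T2Space X] {h₁ h₂ f : X → M} (hf : IsLsc f)
    (h₁f : LocallyWayBelow h₁ f) (h₂f : LocallyWayBelow h₂ f) :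
    ∃ P : ℕ → Set (Set X × M), (∀ i, IsSubordinate f (P i)) ∧ (∀ i x, ∃ p ∈ P i, x ∈ p.1) ∧
      (∀ i, ∀ p ∈ P i, ∃ c, CompactlyContained c p.2 ∧ ∀ y ∈ p.1, h₁ y ≤ c) ∧
      (∀ i, ∀ p ∈ P i, ∃ c, CompactlyContained c p.2 ∧ ∀ y ∈ p.1, h₂ y ≤ c) ∧
      ∀ i j, i < j → ∀ q ∈ P i, ∀ p ∈ P j, (q.1 ∩ p.1).Nonempty → q.2 ≤ p.2 := by
  have step : ∀ Q : {Q : Set (Set X × M) // IsSubordinate f Q}, _ :=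
    fun Q => exists_dominating_cover hf h₁f h₂f Q.2
  choose S hS hcov hS₁ hS₂ hdom using step
  -- `R i` is the family preceding the `i`-th cover; it starts empty, so the first cover has nothing
  -- to dominate.
  let R : ℕ → {Q : Set (Set X × M) // IsSubordinate f Q} :=
    fun n => n.rec ⟨∅, Set.finite_empty, by simp⟩ fun _ Q => ⟨S Q, hS Q⟩
  refine ⟨fun i => S (R i), fun i => hS _, fun i => hcov _, fun i => hS₁ _, fun i => hS₂ _, ?_⟩
  rintro i j hij q hq p hp ⟨x, hxq, hxp⟩
  -- Each intermediate cover has a member containing `x`, so consecutive dominations chain together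
  -- at `x`.
  induction j, hij using Nat.le_induction generalizing p with
  | base => exact hdom (R (i + 1)) q hq p hp ⟨x, hxq, hxp⟩
  | succ j hj ih =>
    obtain ⟨r, hr, hxr⟩ := hcov (R j) x
    exact (ih r hr hxr).trans (hdom (R (j + 1)) r hr p hp ⟨x, hxr, hxp⟩)

/-- Interpolation: if the covering dimension is finite, then two functions locally way below the
lower semicontinuous function `f` are locally way below a lower semicontinuous function which is
itself locally way below `f`. -/
theorem LocallyWayBelow.exists_between [CompactSpace X] [T2Space X] {n : ℕ}
    (hX : CoveringDimLE X n) {h₁ h₂ f : X → M} (hf : IsLsc f)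
    (h₁f : LocallyWayBelow h₁ f) (h₂f : LocallyWayBelow h₂ f) :
    ∃ h, IsLsc h ∧ LocallyWayBelow h₁ h ∧ LocallyWayBelow h₂ h ∧ LocallyWayBelow h f := by
  classical
  obtain ⟨P, hP, hcov, hP₁, hP₂, hdom⟩ := exists_dominating_covers hf h₁f h₂f
  obtain ⟨𝒱, h𝒱o, h𝒱cov, h𝒱ref, h𝒱n⟩ := hX
    {U | IsOpen U ∧ ∀ i ≤ n + 1, ∃ p ∈ P i, U ⊆ p.1} (fun U hU => hU.1) (by
      refine Set.eq_univ_of_forall fun x => ?_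
      choose p hp hxp using fun i => hcov i x
      refine ⟨⋂ i ∈ Set.Iic (n + 1), (p i).1, ⟨?_, fun i hi => ⟨p i, hp i, ?_⟩⟩, ?_⟩
      · exact (Set.finite_Iic _).isOpen_biInter fun i _ => ((hP i).2 _ (hp i)).1
      · exact Set.biInter_subset_of_mem hi
      · exact Set.mem_iInter₂.2 fun i _ => hxp i)
  obtain ⟨t, ht𝒱, htfin, htcov⟩ := isCompact_univ.elim_finite_subcover_image (c := id) h𝒱o
    (by rw [← h𝒱cov, Set.sUnion_eq_biUnion]; rfl)
  lift t to Finset (Set X) using htfin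
  -- `σ x` has between `1` and `n + 1` elements, so its cardinality is a legitimate index of a
  -- cover.
  let σ : X → Finset (Set X) := fun x => t.filter (x ∈ ·)
  have hσ : ∀ {x V}, V ∈ σ x ↔ V ∈ t ∧ x ∈ V := fun {x V} => Finset.mem_filter
  have hσne : ∀ x, (σ x).Nonempty := fun x => by
    obtain ⟨V, hV, hxV⟩ := Set.mem_iUnion₂.1 (htcov (Set.mem_univ x))
    exact ⟨V, hσ.2 ⟨hV, hxV⟩⟩
  have hσn : ∀ x, (σ x).card ≤ n + 1 := fun x => by
    have : ((σ x : Set (Set X))).encard ≤ n + 1 :=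
      (Set.encard_le_encard (t := {V ∈ 𝒱 | x ∈ V})
        fun V hV => ⟨ht𝒱 (hσ.1 hV).1, (hσ.1 hV).2⟩).trans (h𝒱n x)
    rw [Set.encard_coe_eq_coe_finsetCard] at this
    exact_mod_cast this
  have hσmono : ∀ x, ∀ᶠ y in 𝓝 x, σ x ⊆ σ y := fun x => by
    have : ∀ᶠ y in 𝓝 x, ∀ V ∈ σ x, y ∈ V := (Filter.eventually_all_finset _).2 fun V hV =>
      (h𝒱o V (ht𝒱 (hσ.1 hV).1)).mem_nhds (hσ.1 hV).2
    filter_upwards [this] with y hy V hV using hσ.2 ⟨(hσ.1 hV).1, hy V hV⟩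
  -- The piece depends on `σ x` alone, so points with equal `σ` get equal values; `(∅, 0)` is a
  -- dummy for sets that are not of this form.
  have hpick : ∀ s : Finset (Set X), ∃ p : Set X × M,
      ∀ x, σ x = s → p ∈ P s.card ∧ x ∈ p.1 := by
    intro s
    by_cases hs : ∃ x, σ x = s
    · obtain ⟨x, rfl⟩ := hs
      obtain ⟨V, hV⟩ := hσne x
      obtain ⟨U, hU, hVU⟩ := h𝒱ref V (ht𝒱 (hσ.1 hV).1)
      obtain ⟨p, hp, hUp⟩ := hU.2 _ (hσn x)
      exact ⟨p, fun y hy => ⟨hp, hUp (hVU (hσ.1 (hy ▸ hV : V ∈ σ y)).2)⟩⟩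
    · exact ⟨(∅, 0), fun x hx => absurd ⟨x, hx⟩ hs⟩
  choose p hp using hpick
  have hpP : ∀ x, p (σ x) ∈ P (σ x).card := fun x => (hp _ x rfl).1
  have hxp : ∀ x, x ∈ (p (σ x)).1 := fun x => (hp _ x rfl).2
  -- Near `x` either `σ` is unchanged, or it is strictly larger and a later cover with larger values
  -- is used.
  have hle : ∀ x, ∀ᶠ y in 𝓝 x, (p (σ x)).2 ≤ (p (σ y)).2 := fun x => by
    filter_upwards [hσmono x, ((hP _).2 _ (hpP x)).1.mem_nhds (hxp x)] with y hy hyp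
    rcases hy.eq_or_ssubset with h | h
    · rw [h]
    · exact hdom _ _ (Finset.card_lt_card h) _ (hpP x) _ (hpP y) ⟨y, hyp, hxp y⟩
  refine ⟨fun x => (p (σ x)).2, fun a => ?_, fun x => ?_, fun x => ?_, fun x => ?_⟩
  · refine isOpen_iff_mem_nhds.2 fun x hx => ?_
    filter_upwards [hle x] with y hy using hx.trans_le hy
  · obtain ⟨c, hc, hy⟩ := hP₁ _ _ (hpP x)
    exact ⟨c, hc, Filter.mem_of_superset (((hP _).2 _ (hpP x)).1.mem_nhds (hxp x)) hy⟩
  · obtain ⟨c, hc, hy⟩ := hP₂ _ _ (hpP x)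
    exact ⟨c, hc, Filter.mem_of_superset (((hP _).2 _ (hpP x)).1.mem_nhds (hxp x)) hy⟩
  -- Near `x` only finitely many values occur, all from pieces whose closure contains `x`, hence all
  -- `≪ f x`.
  · let Q : Set (Set X × M) := ⋃ i ∈ Set.Iic (n + 1), P i
    have hQ : Q.Finite := (Set.finite_Iic _).biUnion fun i _ => (hP i).1
    obtain ⟨c, hc, hcx⟩ := CompactlyContained.exists_finite_upper_bound (x := f x)
      ((hQ.subset (Set.sep_subset Q fun q => x ∈ closure q.1)).image Prod.snd) (by
        rintro _ ⟨q, ⟨hq, hxq⟩, rfl⟩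
        obtain ⟨i, -, hqi⟩ := Set.mem_iUnion₂.1 hq
        exact ((hP i).2 q hqi).2 x hxq)
    have hfar : ∀ᶠ y in 𝓝 x, ∀ q ∈ Q, y ∈ q.1 → x ∈ closure q.1 := by
      refine (Filter.eventually_all_finite hQ).2 fun q _ => ?_
      by_cases hx : x ∈ closure q.1
      · exact Filter.Eventually.of_forall fun _ _ => hx
      · filter_upwards [isClosed_closure.isOpen_compl.mem_nhds hx] with y hy hyq
        exact absurd (subset_closure hyq) hy
    refine ⟨c, hcx, hfar.mono fun y hy => (hc _ ⟨p (σ y), ⟨?_, ?_⟩, rfl⟩).le⟩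
    · exact Set.mem_iUnion₂.2 ⟨_, hσn y, hpP y⟩
    · exact hy _ (Set.mem_iUnion₂.2 ⟨_, hσn y, hpP y⟩) (hxp y)

end Interpolation

/-! ### Rapidly increasing sequences and the theorem -/

theorem LocallyWayBelow.exists_sequence {X M : Type*} [TopologicalSpace X] [CompactSpace X]
    [T2Space X] [SecondCountableTopology X] [AddCommMonoid M] [PartialOrder M] [CuSemigroup M]
    {n : ℕ} (hX : CoveringDimLE X n) (hM : CountablyBased M) (f : Lsc X M) :
    ∃ u : ℕ → Lsc X M, (∀ k, LocallyWayBelow (u k : X → M) (u (k + 1) : X → M)) ∧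
      IsLUB (Set.range u) f := by
  obtain ⟨B, hB, hBM⟩ := hM
  let R : Set (X → M) := {r | ∃ p ∈ TopologicalSpace.countableBasis X ×ˢ B,
    (p.1.indicator fun _ => p.2) = r ∧ LocallyWayBelow r f}
  have h0 : LocallyWayBelow (0 : X → M) f :=
    fun x => ⟨0, .zero_left _, Filter.Eventually.of_forall fun _ => le_rfl⟩
  have hR : (insert 0 R).Countable := by
    refine Set.Countable.insert _ ((((TopologicalSpace.countable_countableBasis X).prod hB).image
      fun p => p.1.indicator fun _ => p.2).mono ?_)
    rintro r ⟨p, hp, hr, -⟩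
    exact ⟨p, hp, hr⟩
  obtain ⟨r, hr⟩ := hR.exists_eq_range (Set.insert_nonempty _ _)
  have hrf : ∀ k, LocallyWayBelow (r k) f := by
    intro k
    have : r k ∈ insert 0 R := hr ▸ ⟨k, rfl⟩
    rcases this with h | ⟨_, _, _, h⟩
    · rwa [h]
    · exact h
  have step : ∀ (k : ℕ) (h : {h : Lsc X M // LocallyWayBelow (h : X → M) f}),
      ∃ h' : {h : Lsc X M // LocallyWayBelow (h : X → M) f},
        LocallyWayBelow (h.1 : X → M) (h'.1 : X → M) ∧ LocallyWayBelow (r k) (h'.1 : X → M) := by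
    intro k h
    obtain ⟨g, hg, h1, h2, h3⟩ := LocallyWayBelow.exists_between hX f.2 h.2 (hrf k)
    exact ⟨⟨⟨g, hg⟩, h3⟩, h1, h2⟩
  choose S hS hSr using step
  let u : ℕ → {h : Lsc X M // LocallyWayBelow (h : X → M) f} :=
    fun k => k.rec ⟨0, h0⟩ S
  refine ⟨fun k => (u k).1, fun k => hS k (u k), ?_, ?_⟩
  · rintro _ ⟨k, rfl⟩
    exact (u k).2.le
  · intro g hg x
    obtain ⟨b, hbB, hb, hbs⟩ := hBM ((f : X → M) x)
    refine hbs.2 ?_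
    rintro _ ⟨m, rfl⟩
    have hbx : CompactlyContained (b m) ((f : X → M) x) := (hb m).trans_le (hbs.1 ⟨m + 1, rfl⟩)
    -- Regularity gives a basic `K` with `b m ≪ f` on its closure, so this step function is among
    -- those absorbed.
    obtain ⟨K, hK, hxK, hKf⟩ := (TopologicalSpace.isBasis_countableBasis X).exists_closure_subset
      ((f.2 (b m)).mem_nhds hbx)
    have hmem : (K.indicator fun _ => b m) ∈ insert 0 R :=
      .inr ⟨(K, b m), ⟨hK, hbB m⟩, rfl, LocallyWayBelow.indicator fun y hy => hKf hy⟩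
    rw [hr] at hmem
    obtain ⟨k, hk⟩ := hmem
    have h1 : b m ≤ ((u (k + 1)).1 : X → M) x := by
      have := (hSr k (u k)).le x
      rwa [hk, Set.indicator_of_mem hxK] at this
    exact h1.trans (hg ⟨k + 1, rfl⟩ x)

theorem mainTheorem3 (X : Type*) [TopologicalSpace X] [CompactSpace X] [T2Space X]
    [SecondCountableTopology X] (hX : coveringDim X < ⊤)
    (M : Type*) [AddCommMonoid M] [PartialOrder M] [CuSemigroup M] (hM : CountablyBased M) :
    CuSemigroup (Lsc X M) := by
  obtain ⟨_, ⟨n, rfl, hn⟩, -⟩ := sInf_lt_iff.1 hX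
  -- The converse of `LocallyWayBelow.compactlyContained`: `h ≪ f` puts `h` below a term of a
  -- sequence approximating `f`.
  have hwb : ∀ {h f : Lsc X M}, CompactlyContained h f →
      LocallyWayBelow (h : X → M) (f : X → M) := by
    intro h f hhf
    obtain ⟨u, hu, hs⟩ := LocallyWayBelow.exists_sequence hn hM f
    obtain ⟨k, hk⟩ := hhf u f (monotone_nat_of_le_succ fun k => (hu k).le) hs le_rfl
    exact (hu k).mono hk (hs.1 ⟨k + 1, rfl⟩)
  exact
    { add_le_add_left := fun a b hab c x => add_le_add_left (hab x) _
      zero_le' := fun f x => CuSemigroup.zero_le' _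
      exists_isLUB := fun u hu =>
        (Lsc.exists_pointwise_isLUB hu).imp fun _ hg => Lsc.isLUB_of_pointwise hg
      exists_rapidlyIncreasing := fun f =>
        (LocallyWayBelow.exists_sequence hn hM f).imp fun _ hu =>
          ⟨fun k => (hu.1 k).compactlyContained, hu.2⟩
      isLUB_add := fun u v f g hu hv hf hg => Lsc.isLUB_of_pointwise fun x =>
        CuSemigroup.isLUB_add _ _ _ _ (fun i j hij => hu hij x) (fun i j hij => hv hij x)
          (Lsc.pointwise_isLUB hu hf x) (Lsc.pointwise_isLUB hv hg x)
      compactlyContained_add := fun f f' g g' hf hg =>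
        LocallyWayBelow.compactlyContained ((hwb hf).add (hwb hg)) }
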